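/- All graphs are finite and simple. For a graph $G$, a proper vertex colouring $c$ of $G$ is called distinguishing if the only automorphism $\varphi$ of $G$ with $c(\varphi(v))=c(v)$ for all $v\in V(G)$ is the identity; $\chi_D(G)$ denotes the minimum number of colours in a proper distinguishing vertex colouring of $G$. Let $\Delta(G)$, $\alpha(G)$ and $\omega(G)$ denote the maximum degree, the independence number and the clique number of $G$. For integers $a,b\ge 0$, let $aK_1+K_b$ denote the join of $a$ isolated vertices and a complete graph on $b$ vertices (the disjoint union of the two graphs with all edges between them added). A graph is $(C_4,2K_2)$-free if it contains neither the cycle $C_4$ nor the disjoint union $2K_2$ of two edges as an induced subgraph. **Theorem.** If $G$ is a connected $(C_4,2K_2)$-free graph, then \[\chi_D(G)\le \Delta(G)+1,\] with equality if and only if $G\cong \alpha(G)K_1+K_{\omega(G)-1}$ or $G\cong C_5$. -/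

import Mathlib

namespace DistinguishingChromatic

/-- A vertex colouring `c` of `G` fixes every vertex: the only automorphism of `G` that preserves
all colours is the identity. -/
def IsDistinguishing {V α : Type*} (G : SimpleGraph V) (c : V → α) : Prop :=
  ∀ φ : G ≃g G, (∀ v, c (φ v) = c v) → ∀ v, φ v = v

/-- The distinguishing chromatic number `χ_D(G)`: the least number of colours that suffice for a
proper distinguishing vertex colouring (for finite `G` this set of numbers is nonempty, see
`exists_distinguishing_coloring`). -/
noncomputable def distChromaticNumber {V : Type*} (G : SimpleGraph V) : ℕ :=
  sInf {k : ℕ | ∃ c : G.Coloring (Fin k), IsDistinguishing G c}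

/-- A finite graph has a proper distinguishing colouring: give all vertices different colours. -/
theorem exists_distinguishing_coloring {V : Type*} [Fintype V] (G : SimpleGraph V) :
    ∃ c : G.Coloring (Fin (Fintype.card V)), IsDistinguishing G c :=
  ⟨SimpleGraph.Coloring.mk (Fintype.equivFin V)
      fun h e => G.ne_of_adj h ((Fintype.equivFin V).injective e),
    fun _ h v => (Fintype.equivFin V).injective (h v)⟩

/-- `G` is `H`-free: `H` is not (isomorphic to) an induced subgraph of `G`. -/
def IsInducedFree {V W : Type*} (H : SimpleGraph W) (G : SimpleGraph V) : Prop :=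
  ¬ H.IsIndContained G

/-- The graph `2K₂`, the disjoint union of two edges. -/
def twoK2 : SimpleGraph (Fin 2 ⊕ Fin 2) :=
  SimpleGraph.sum (SimpleGraph.completeGraph (Fin 2)) (SimpleGraph.completeGraph (Fin 2))

/-- The join `G + H`: the disjoint union of `G` and `H` with all edges between them added. -/
def join {V W : Type*} (G : SimpleGraph V) (H : SimpleGraph W) : SimpleGraph (V ⊕ W) :=
  SimpleGraph.sum G H ⊔ completeBipartiteGraph V W

/-- The graph `a K₁ + K_b`, the join of `a` isolated vertices and a clique on `b` vertices. -/
def isolatedJoinClique (a b : ℕ) : SimpleGraph (Fin a ⊕ Fin b) :=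
  join (SimpleGraph.emptyGraph (Fin a)) (SimpleGraph.completeGraph (Fin b))

end DistinguishingChromatic

/-!
A `(C₄, 2K₂)`-free graph is either a split graph or it contains an induced `C₅`, and in the latter
case every other vertex is adjacent to all of the cycle or to none of it; the vertices of the first
kind (the hub) form a clique and those of the second kind an independent set
(`exists_isClique_isIndepSet_compl`, `fiveCycle_trichotomy`).

*Upper bound.* Two false twins must receive different colours, so colourings of the graph
`conflictGraph G` are considered, in which false twins are joined as well. In a split graph such a
colouring is distinguishing once it is injective on the clique
(`isDistinguishing_of_injOn_clique`). In the presence of an induced `C₅` the degrees separate the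
hub, the cycle and the rest, so it suffices to be injective on the hub and to use the colours
`0, 1, 0, 1, 2` along the cycle (`isDistinguishing_of_fiveCycle`). In both cases the colouring of
the clique (and the cycle) extends greedily to the independent part: a vertex `v` there has fewer
than `deg v + t` conflicts, where `t` is the size of its twin class, and every neighbour of `v` is
adjacent to the other neighbours of `v` and to all its twins, whence `deg v + t ≤ Δ + 1`
(`degree_add_card_twinClass_le`).

*Equality.* If `deg v + t = Δ + 1`, then no edge leaves the set of neighbours and twins of `v`, so
by connectedness `G` is the join of a clique with an independent set
(`adj_or_mem_twinClass_of_maxDegree_lt`, `nonempty_iso_isolatedJoinClique`). Otherwise `Δ` colours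
suffice, unless the hub of an induced `C₅` is empty and `G` is `C₅`. Conversely, in
`a K₁ + K_b` any two vertices are adjacent or twins, so all colours differ, and `C₅` is not
2-colourable.
-/

namespace DistinguishingChromatic

variable {V : Type*}

/-! ### Forbidden induced subgraphs -/

/-- A copy of `C₄` in a `C₄`-free graph has a chord. -/
theorem adj_or_adj_of_isInducedFree_cycleGraph_four {G : SimpleGraph V}
    (hC4 : IsInducedFree (SimpleGraph.cycleGraph 4) G) {a b c d : V}
    (hab : G.Adj a b) (hbc : G.Adj b c) (hcd : G.Adj c d) (hda : G.Adj d a)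
    (hac : a ≠ c) (hbd : b ≠ d) : G.Adj a c ∨ G.Adj b d := by
  by_contra! h
  obtain ⟨h1, h2⟩ := h
  refine hC4 ⟨⟨⟨![a, b, c, d], ?_⟩, ?_⟩⟩
  · intro i j hij
    have := hab.ne; have := hbc.ne; have := hcd.ne; have := hda.ne
    fin_cases i <;> fin_cases j <;> simp_all
  · intro i j
    have h1' := mt G.adj_symm h1
    have h2' := mt G.adj_symm h2
    have := hab.symm; have := hbc.symm; have := hcd.symm; have := hda.symm
    change G.Adj (![a, b, c, d] i) (![a, b, c, d] j) ↔ _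
    fin_cases i <;> fin_cases j <;>
      simp_all [SimpleGraph.cycleGraph_adj] <;> decide

/-- Two edges of a `2K₂`-free graph are joined by an edge or share a vertex. -/
theorem adj_of_isInducedFree_twoK2 {G : SimpleGraph V} (h2K2 : IsInducedFree twoK2 G)
    {a b c d : V} (hab : G.Adj a b) (hcd : G.Adj c d) :
    G.Adj a c ∨ G.Adj a d ∨ G.Adj b c ∨ G.Adj b d := by
  by_contra! h
  obtain ⟨h1, h2, h3, h4⟩ := h
  have e1 : a ≠ c := by rintro rfl; exact h2 hcd
  have e2 : a ≠ d := by rintro rfl; exact h1 hcd.symm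
  have e3 : b ≠ c := by rintro rfl; exact h1 hab
  have e4 : b ≠ d := by rintro rfl; exact h2 hab
  have hadj : ∀ i j, G.Adj (Sum.elim ![a, b] ![c, d] i) (Sum.elim ![a, b] ![c, d] j) ↔
      twoK2.Adj i j := by
    have := hab.symm; have := hcd.symm
    have h1' := mt G.adj_symm h1
    have h2' := mt G.adj_symm h2
    have h3' := mt G.adj_symm h3
    have h4' := mt G.adj_symm h4
    rintro (i | i) (j | j) <;> fin_cases i <;> fin_cases j <;> simp_all [twoK2]
  refine h2K2 ⟨⟨⟨Sum.elim ![a, b] ![c, d], ?_⟩, hadj _ _⟩⟩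
  have := hab.ne; have := hcd.ne
  rintro (i | i) (j | j) hij <;> fin_cases i <;> fin_cases j <;> simp_all

/-- Five vertices with the adjacencies and non-adjacencies of a 5-cycle span an induced `C₅`.
They need not be assumed distinct: distinct vertices of `C₅` have distinct neighbourhoods. -/
theorem nonempty_cycleGraph_five_embedding {G : SimpleGraph V} {a b c d e : V}
    (hab : G.Adj a b) (hbc : G.Adj b c) (hcd : G.Adj c d) (hde : G.Adj d e) (hea : G.Adj e a)
    (hac : ¬ G.Adj a c) (had : ¬ G.Adj a d) (hbd : ¬ G.Adj b d) (hbe : ¬ G.Adj b e)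
    (hce : ¬ G.Adj c e) : Nonempty (SimpleGraph.cycleGraph 5 ↪g G) := by
  have hadj : ∀ i j, G.Adj (![a, b, c, d, e] i) (![a, b, c, d, e] j) ↔
      (SimpleGraph.cycleGraph 5).Adj i j := by
    intro i j
    have := mt G.adj_symm hac
    have := mt G.adj_symm had
    have := mt G.adj_symm hbd
    have := mt G.adj_symm hbe
    have := mt G.adj_symm hce
    have := hab.symm; have := hbc.symm; have := hcd.symm; have := hde.symm; have := hea.symm
    fin_cases i <;> fin_cases j <;>
      simp_all [SimpleGraph.cycleGraph_adj] <;> decide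
  refine ⟨⟨⟨![a, b, c, d, e], fun i j hij => ?_⟩, hadj _ _⟩⟩
  have key : ∀ i j : Fin 5, (∀ l, (SimpleGraph.cycleGraph 5).Adj i l ↔
      (SimpleGraph.cycleGraph 5).Adj j l) → i = j := by
    decide
  exact key i j fun l => by rw [← hadj, ← hadj, hij]

/-! ### Graphs without an induced five-cycle are split -/

/-- A `(C₄, 2K₂)`-free graph without induced `C₅` is a split graph.

Take a maximum clique `K` whose degree sum is as large as possible, and suppose that an edge `xy`
avoids `K`. The `C₄`- and `2K₂`-freeness make `x` and `y` together miss exactly one vertex `a`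
of `K`, and one of them, say `y`, misses nothing else. Exchanging `a` for `y` yields another
maximum clique, so `deg y ≤ deg a`, and `a` has a neighbour `z` which `y` has not. The vertices
`a, z, x, y` and a further vertex of `K` missed by `x` and `z` form an induced `C₅`. -/
theorem exists_isClique_isIndepSet_compl [Fintype V] {G : SimpleGraph V}
    (hC4 : IsInducedFree (SimpleGraph.cycleGraph 4) G) (h2K2 : IsInducedFree twoK2 G)
    (hC5 : IsEmpty (SimpleGraph.cycleGraph 5 ↪g G)) :
    ∃ K : Finset V, G.IsClique K ∧ ∀ u ∉ K, ∀ v ∉ K, ¬ G.Adj u v := by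
  classical
  obtain ⟨K, hKmem, hKmax⟩ := Finset.exists_max_image
    (Finset.univ.filter fun s : Finset V => G.IsNClique G.cliqueNum s)
    (fun s => ∑ v ∈ s, G.degree v)
    (by obtain ⟨s, hs⟩ := G.exists_isNClique_cliqueNum; exact ⟨s, by simpa using hs⟩)
  have hKN : G.IsNClique G.cliqueNum K := by simpa using hKmem
  have hK := hKN.isClique
  have hlarge : ∀ s : Finset V, G.IsClique s → s.card ≤ K.card := fun s hs => by
    rw [hKN.card_eq]; exact SimpleGraph.IsClique.card_le_cliqueNum (tc := hs)
  have hKadj : ∀ {u v}, u ∈ K → v ∈ K → u ≠ v → G.Adj u v := fun hu hv h => hK hu hv h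
  refine ⟨K, hK, ?_⟩
  -- The traces on `K` of the neighbourhoods of the ends of an outside edge are nested.
  have hnest : ∀ {x y}, x ∉ K → y ∉ K → G.Adj x y →
      (∀ w ∈ K, G.Adj x w → G.Adj y w) ∨ (∀ w ∈ K, G.Adj y w → G.Adj x w) := by
    intro x y hx hy hxy
    by_contra! h
    obtain ⟨⟨s, hs, hxs, hys⟩, t, ht, hyt, hxt⟩ := h
    have hst : s ≠ t := by rintro rfl; exact hxt hxs
    rcases adj_or_adj_of_isInducedFree_cycleGraph_four hC4 hxy hyt (hKadj ht hs hst.symm)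
      hxs.symm (by rintro rfl; exact hx ht) (by rintro rfl; exact hy hs) with h | h
    · exact hxt h
    · exact hys h
  -- The end `y` with the larger trace misses exactly one vertex `s` of `K`, by maximality of `K` and
  -- `2K₂`-freeness; the other end `x` misses a second vertex `t`, as otherwise `x`, `y` and
  -- `K \ {s}` would form a larger clique.
  have hmiss : ∀ {x y}, x ∉ K → y ∉ K → G.Adj x y → (∀ w ∈ K, G.Adj x w → G.Adj y w) →
      ∃ s ∈ K, ∃ t ∈ K, s ≠ t ∧ ¬ G.Adj x s ∧ ¬ G.Adj x t ∧ ¬ G.Adj y s ∧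
        ∀ w ∈ K, w ≠ s → G.Adj y w := by
    intro x y hx hy hxy hsub
    obtain ⟨s, hs, hys⟩ : ∃ s ∈ K, ¬ G.Adj y s := by
      by_contra! h
      have := hlarge (insert y K) (by
        rw [Finset.coe_insert, SimpleGraph.isClique_insert]
        exact ⟨hK, fun b hb _ => h b hb⟩)
      rw [Finset.card_insert_of_notMem hy] at this
      omega
    have hxs : ¬ G.Adj x s := fun h => hys (hsub s hs h)
    have hy' : ∀ w ∈ K, w ≠ s → G.Adj y w := by
      intro w hw hws
      by_contra hyw
      rcases adj_of_isInducedFree_twoK2 h2K2 hxy (hKadj hw hs hws) with h | h | h | h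
      · exact hyw (hsub w hw h)
      · exact hxs h
      · exact hyw h
      · exact hys h
    obtain ⟨t, ht, hts, hxt⟩ : ∃ t ∈ K, t ≠ s ∧ ¬ G.Adj x t := by
      by_contra! h
      have := hlarge (insert x (insert y (K.erase s))) (by
        rw [Finset.coe_insert, SimpleGraph.isClique_insert, Finset.coe_insert,
          SimpleGraph.isClique_insert]
        refine ⟨⟨hK.subset (by simp), fun b hb _ => ?_⟩, fun b hb _ => ?_⟩
        · simp only [Finset.coe_erase, Set.mem_sdiff, Finset.mem_coe, Set.mem_singleton_iff] at hb
          exact hy' b hb.1 hb.2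
        · simp only [Finset.coe_erase, Set.mem_insert_iff, Set.mem_sdiff, Finset.mem_coe,
            Set.mem_singleton_iff] at hb
          rcases hb with rfl | hb
          · exact hxy
          · exact h b hb.1 hb.2)
      rw [Finset.card_insert_of_notMem (by simp [hxy.ne, hx]),
        Finset.card_insert_of_notMem (by simp [hy]), Finset.card_erase_of_mem hs] at this
      omega
    exact ⟨s, hs, t, ht, hts.symm, hxs, hxt, hys, hy'⟩
  have hmain : ∀ {x y}, x ∉ K → y ∉ K → G.Adj x y → (∀ w ∈ K, G.Adj x w → G.Adj y w) →
      False := by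
    intro x y hx hy hxy hsub
    obtain ⟨a, ha, -, -, -, hxa, -, hya, hy'⟩ := hmiss hx hy hxy hsub
    have hyE : y ∉ K.erase a := by simp [hy]
    have hK' : G.IsNClique G.cliqueNum (insert y (K.erase a)) := by
      refine ⟨?_, ?_⟩
      · rw [Finset.coe_insert, SimpleGraph.isClique_insert]
        refine ⟨hK.subset (by simp), fun b hb _ => ?_⟩
        simp only [Finset.coe_erase, Set.mem_sdiff, Finset.mem_coe, Set.mem_singleton_iff] at hb
        exact hy' b hb.1 hb.2
      · rw [Finset.card_insert_of_notMem hyE, Finset.card_erase_add_one ha, hKN.card_eq]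
    -- This is where the choice of `K` with the largest degree sum is used.
    have hdeg : G.degree y ≤ G.degree a := by
      have := hKmax _ (by simpa using hK')
      rw [Finset.sum_insert hyE, ← Finset.add_sum_erase K _ ha] at this
      omega
    obtain ⟨z, haz, hyz⟩ : ∃ z, G.Adj a z ∧ ¬ G.Adj y z := by
      by_contra! h
      have : G.neighborFinset a ⊂ G.neighborFinset y := by
        refine (Finset.ssubset_iff_of_subset fun z hz => ?_).2 ⟨x, ?_, ?_⟩
        · simpa using h z (by simpa using hz)
        · simpa using hxy.symm
        · simpa using fun h => hxa (G.adj_symm h)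
      have := Finset.card_lt_card this
      simp only [SimpleGraph.card_neighborFinset_eq_degree] at this
      omega
    have hz : z ∉ K := fun hz => hyz (hy' z hz haz.ne')
    have hzx : G.Adj z x := by
      rcases adj_of_isInducedFree_twoK2 h2K2 haz hxy with h | h | h | h
      · exact absurd h.symm hxa
      · exact absurd h.symm hya
      · exact h
      · exact absurd h.symm hyz
    have hsub' : ∀ w ∈ K, G.Adj x w → G.Adj z w :=
      (hnest hx hz hzx.symm).resolve_right fun h => hxa (h a ha haz.symm)
    obtain ⟨c, hc, -, -, -, hxc, -, hzc, -⟩ := hmiss hx hz hzx.symm hsub'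
    have hca : c ≠ a := by rintro rfl; exact hzc haz.symm
    obtain ⟨f⟩ := nonempty_cycleGraph_five_embedding haz hzx hxy (hy' c hc hca)
      (hKadj hc ha hca) (mt G.adj_symm hxa) (mt G.adj_symm hya) (mt G.adj_symm hyz) hzc hxc
    exact hC5.false f
  intro x hx y hy hxy
  rcases hnest hx hy hxy with h | h
  · exact hmain hx hy hxy h
  · exact hmain hy hx hxy.symm h

/-! ### Twin-separating colourings and split graphs -/

/-- The conflict graph of `G`: two vertices are joined if they are adjacent in `G` or are distinct
with the same neighbourhood in `G` (false twins). Its proper colourings are the proper colourings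
of `G` in which false twins get different colours. -/
def conflictGraph (G : SimpleGraph V) : SimpleGraph V where
  Adj u v := u ≠ v ∧ (G.Adj u v ∨ G.neighborSet u = G.neighborSet v)
  symm := ⟨fun _ _ h => ⟨h.1.symm, h.2.imp G.adj_symm Eq.symm⟩⟩
  loopless := ⟨fun _ h => h.1 rfl⟩

open Classical in
/-- The false-twin class of `v`: all vertices, `v` included, with the same neighbourhood as `v`. -/
noncomputable def twinClass [Fintype V] (G : SimpleGraph V) (v : V) : Finset V :=
  {u | G.neighborSet u = G.neighborSet v}

theorem mem_twinClass [Fintype V] {G : SimpleGraph V} {u v : V} :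
    u ∈ twinClass G v ↔ G.neighborSet u = G.neighborSet v := by
  simp [twinClass]

theorem mem_twinClass_self [Fintype V] (G : SimpleGraph V) (v : V) : v ∈ twinClass G v :=
  mem_twinClass.2 rfl

theorem adj_congr_of_neighborSet_eq {G : SimpleGraph V} {u v : V}
    (h : G.neighborSet u = G.neighborSet v) (w : V) : G.Adj u w ↔ G.Adj v w :=
  Set.ext_iff.1 h w

theorem adj_of_mem_twinClass [Fintype V] {G : SimpleGraph V} {u v w : V}
    (hu : u ∈ twinClass G v) (hw : G.Adj v w) : G.Adj w u :=
  ((adj_congr_of_neighborSet_eq (mem_twinClass.1 hu) w).2 hw).symm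

/-- Exchanging two false twins is an automorphism, so a distinguishing colouring tells them
apart. -/
theorem IsDistinguishing.eq_of_neighborSet_eq {α : Type*} {G : SimpleGraph V} {c : V → α}
    (hc : IsDistinguishing G c) {u v : V} (h : G.neighborSet u = G.neighborSet v)
    (huv : c u = c v) : u = v := by
  classical
  have hadj := adj_congr_of_neighborSet_eq h
  let φ : G ≃g G :=
    { toEquiv := Equiv.swap u v
      map_rel_iff' := by
        intro a b
        have h1 := hadj a
        have h2 := hadj b
        have h3 := hadj u
        have h4 := hadj v
        simp only [Equiv.swap_apply_def]
        split_ifs <;> simp_all [G.adj_comm] }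
  have := hc φ (fun w => by
    change c (Equiv.swap u v w) = c w
    rw [Equiv.swap_apply_def]
    split_ifs <;> simp_all) v
  simpa [φ] using this

/-- Greedy extension of a partial colouring: a proper colouring of `S` with `k` colours extends
to the whole graph if every vertex outside `S` has degree less than `k`. -/
theorem exists_coloring_extending [Fintype V] (H : SimpleGraph V) [DecidableRel H.Adj] {k : ℕ}
    (S : Finset V) (c₀ : V → ℕ) (hlt : ∀ v ∈ S, c₀ v < k)
    (hS : ∀ u ∈ S, ∀ v ∈ S, H.Adj u v → c₀ u ≠ c₀ v) (hdeg : ∀ v ∉ S, H.degree v < k) :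
    ∃ c : H.Coloring (Fin k), ∀ v ∈ S, (c v : ℕ) = c₀ v := by
  classical
  have key : ∀ T : Finset V, ∃ c : V → ℕ, (∀ v ∈ S, c v = c₀ v) ∧ (∀ v ∈ S ∪ T, c v < k) ∧
      ∀ u ∈ S ∪ T, ∀ v ∈ S ∪ T, H.Adj u v → c u ≠ c v := by
    intro T
    induction T using Finset.induction_on with
    | empty => exact ⟨c₀, fun _ _ => rfl, by simpa using hlt, by simpa using hS⟩
    | insert a T _ ih =>
      obtain ⟨c, hcS, hck, hc⟩ := ih
      rw [Finset.union_insert]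
      by_cases ha : a ∈ S ∪ T
      · rw [Finset.insert_eq_of_mem ha]
        exact ⟨c, hcS, hck, hc⟩
      · have haS : a ∉ S := fun h => ha (Finset.mem_union_left _ h)
        obtain ⟨i, hi, hic⟩ : ∃ i ∈ Finset.range k, i ∉ (H.neighborFinset a).image c :=
          Finset.exists_mem_notMem_of_card_lt_card <| by
            rw [Finset.card_range]
            exact Finset.card_image_le.trans_lt (by simpa using hdeg a haS)
        have hne : ∀ v, H.Adj a v → c v ≠ i := fun v hv h =>
          hic (Finset.mem_image.2 ⟨v, by simpa using hv, h⟩)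
        refine ⟨Function.update c a i, fun v hv => ?_, fun v hv => ?_, fun u hu v hv huv => ?_⟩
        · rw [Function.update_of_ne (by rintro rfl; exact haS hv), hcS v hv]
        · by_cases hva : v = a
          · subst hva; simpa using hi
          · rw [Function.update_of_ne hva]
            exact hck v (Finset.mem_of_mem_insert_of_ne hv hva)
        · by_cases hua : u = a
          · subst hua
            rw [Function.update_self, Function.update_of_ne huv.ne']
            exact (hne v huv).symm
          · by_cases hva : v = a
            · subst hva
              rw [Function.update_self, Function.update_of_ne huv.ne]
              exact hne u huv.symm
            · rw [Function.update_of_ne hua, Function.update_of_ne hva]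
              exact hc u (Finset.mem_of_mem_insert_of_ne hu hua) v
                (Finset.mem_of_mem_insert_of_ne hv hva) huv
  obtain ⟨c, hcS, hck, hc⟩ := key Finset.univ
  refine ⟨SimpleGraph.Coloring.mk (fun v => ⟨c v, hck v (by simp)⟩) fun {u v} huv h => ?_, hcS⟩
  exact hc u (by simp) v (by simp) huv (congrArg Fin.val h)

theorem degree_conflictGraph_lt [Fintype V] (G : SimpleGraph V) [DecidableRel G.Adj]
    [DecidableRel (conflictGraph G).Adj] (v : V) :
    (conflictGraph G).degree v < G.degree v + (twinClass G v).card := by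
  classical
  have hsub : (conflictGraph G).neighborFinset v ⊆
      G.neighborFinset v ∪ (twinClass G v).erase v := by
    intro u hu
    obtain ⟨hne, h | h⟩ : (conflictGraph G).Adj v u := by simpa using hu
    · simp [h]
    · simp [hne.symm, mem_twinClass, h]
  have h1 := (Finset.card_le_card hsub).trans (Finset.card_union_le _ _)
  have h2 := Finset.card_erase_lt_of_mem (mem_twinClass_self G v)
  simp only [SimpleGraph.card_neighborFinset_eq_degree] at h1
  omega

/-- Proper colourings of the conflict graph are proper colourings of the graph. -/
theorem distChromaticNumber_le_of_conflictGraph_coloring {G : SimpleGraph V} {k : ℕ}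
    (c : (conflictGraph G).Coloring (Fin k)) (hc : IsDistinguishing G c) :
    distChromaticNumber G ≤ k :=
  Nat.sInf_le ⟨SimpleGraph.Coloring.mk c fun h => c.valid ⟨h.ne, Or.inl h⟩, hc⟩

/-- A colour-preserving automorphism that fixes a set `K` containing all neighbours of `v` fixes
`v`, if false twins have different colours. -/
theorem apply_eq_of_neighborSet_subset {α : Type*} {G : SimpleGraph V}
    (c : (conflictGraph G).Coloring α) (φ : G ≃g G) (hφ : ∀ v, c (φ v) = c v) {K : Finset V}
    (hK : ∀ w ∈ K, φ w = w) {v : V} (hv : ∀ w, G.Adj v w → w ∈ K)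
    (hφv : ∀ w, G.Adj (φ v) w → w ∈ K) : φ v = v := by
  by_contra hne
  refine c.valid (v := φ v) (w := v) ⟨hne, Or.inr ?_⟩ (hφ v)
  ext w
  simp only [SimpleGraph.mem_neighborSet]
  constructor
  · intro h
    have := hK w (hφv w h)
    rwa [← this, φ.map_adj_iff] at h
  · intro h
    have := hK w (hv w h)
    rwa [← this, φ.map_adj_iff]

/-- In a split graph, a proper colouring of the conflict graph is distinguishing as soon as it is
injective on the clique.

If a colour-preserving automorphism moves a clique vertex `x` to `y`, then `y` is outside the
clique, all other clique vertices are fixed, and `x` and `y` turn out to be false twins of the same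
colour. -/
theorem isDistinguishing_of_injOn_clique {α : Type*} {G : SimpleGraph V} {K : Finset V}
    (hI : ∀ u ∉ K, ∀ v ∉ K, ¬ G.Adj u v) (hK : G.IsClique K)
    (c : (conflictGraph G).Coloring α) (hc : Set.InjOn c K) : IsDistinguishing G c := by
  intro φ hφ
  have hI' : ∀ {u w}, u ∉ K → G.Adj u w → w ∈ K := fun {u w} hu h => by
    by_contra hw
    exact hI u hu w hw h
  have hfix : ∀ x ∈ K, φ x ∈ K → φ x = x := fun x hx h => hc h hx (hφ x)
  have hKfix : ∀ x ∈ K, φ x = x := by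
    intro x hx
    by_contra hne
    have hy : φ x ∉ K := fun h => hne (hfix x hx h)
    have hother : ∀ z ∈ K, z ≠ x → φ z = z := fun z hz hzx =>
      hfix z hz (hI' hy (φ.map_adj_iff.2 (hK hx hz hzx.symm)))
    refine c.valid (v := φ x) (w := x) ⟨hne, Or.inr ?_⟩ (hφ x)
    have hxy : ¬ G.Adj (φ x) x := fun h => c.valid ⟨h.ne, Or.inl h⟩ (hφ x)
    ext w
    simp only [SimpleGraph.mem_neighborSet]
    constructor
    · intro h
      have hw : w ≠ x := by rintro rfl; exact hxy h
      exact hK hx (hI' hy h) hw.symm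
    · intro h
      have hadj : G.Adj (φ x) (φ w) := φ.map_adj_iff.2 h
      -- `φ w` is a clique vertex other than `x`, hence fixed, so it is `w` itself.
      have hwx : φ w ≠ x := fun e => hxy (by rwa [e] at hadj)
      have := φ.injective (hother _ (hI' hy hadj) hwx)
      rwa [this] at hadj
  intro v
  by_cases hv : v ∈ K
  · exact hKfix v hv
  · refine apply_eq_of_neighborSet_subset c φ hφ hKfix (fun w h => hI' hv h) fun w h => hI' ?_ h
    intro h'
    exact hv (φ.injective (hKfix _ h') ▸ h')

/-- The colouring bound for split graphs: colour the clique injectively and extend greedily. -/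
theorem distChromaticNumber_le_of_split [Fintype V] {G : SimpleGraph V} [DecidableRel G.Adj]
    {K : Finset V} (hI : ∀ u ∉ K, ∀ v ∉ K, ¬ G.Adj u v) (hK : G.IsClique K) {k : ℕ}
    (hKk : K.card ≤ k) (hk : ∀ v ∉ K, G.degree v + (twinClass G v).card ≤ k) :
    distChromaticNumber G ≤ k := by
  classical
  let c₀ : V → ℕ := fun v => if h : v ∈ K then K.equivFin ⟨v, h⟩ else 0
  have hc₀ : ∀ v (h : v ∈ K), c₀ v = K.equivFin ⟨v, h⟩ := fun v h => dif_pos h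
  have hinj : ∀ u ∈ K, ∀ v ∈ K, c₀ u = c₀ v → u = v := by
    intro u hu v hv h
    rw [hc₀ u hu, hc₀ v hv] at h
    simpa using K.equivFin.injective (Fin.ext h)
  obtain ⟨c, hc⟩ := exists_coloring_extending (conflictGraph G) (k := k) K c₀
    (fun v hv => by rw [hc₀ v hv]; exact (Fin.is_lt _).trans_le hKk)
    (fun u hu v hv huv h => huv.1 (hinj u hu v hv h))
    (fun v hv => (degree_conflictGraph_lt G v).trans_le (hk v hv))
  refine distChromaticNumber_le_of_conflictGraph_coloring c
    (isDistinguishing_of_injOn_clique hI hK c fun u hu v hv h => hinj u hu v hv ?_)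
  rw [← hc u hu, ← hc v hv, h]

/-! ### Extremal degree, complete split graphs and lower bounds -/

/-- A nonempty set of vertices of a connected graph that is closed under adjacency is everything. -/
theorem mem_of_connected_of_closed {G : SimpleGraph V} (hG : G.Connected) {A : Set V} {v : V}
    (hv : v ∈ A) (hA : ∀ u ∈ A, ∀ w, G.Adj u w → w ∈ A) (u : V) : u ∈ A := by
  have h := (SimpleGraph.reachable_iff_reflTransGen v u).1 (hG.preconnected v u)
  induction h with
  | refl => exact hv
  | tail _ hbc ih => exact hA _ ih _ hbc

theorem eq_of_connected_of_forall_not_adj {G : SimpleGraph V} (hG : G.Connected) {v : V}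
    (h : ∀ w, ¬ G.Adj v w) (u : V) : u = v :=
  mem_of_connected_of_closed hG (A := {v}) rfl
    (by rintro x rfl w hw; exact absurd hw (h w)) u

section TwinBound

variable [Fintype V] {G : SimpleGraph V} [DecidableRel G.Adj]

theorem card_erase_union_twinClass [DecidableEq V] {v w : V} (hw : G.Adj v w) :
    ((G.neighborFinset v).erase w ∪ twinClass G v).card + 1 =
      G.degree v + (twinClass G v).card := by
  rw [Finset.card_union_of_disjoint, add_right_comm,
    Finset.card_erase_add_one (by simpa using hw), SimpleGraph.card_neighborFinset_eq_degree]
  rw [Finset.disjoint_left]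
  intro x hx hxT
  have hx' : G.Adj v x := by simpa using Finset.mem_of_mem_erase hx
  exact (adj_of_mem_twinClass hxT hx').ne rfl

theorem erase_union_twinClass_subset [DecidableEq V] {v w : V}
    (hv : G.IsClique (G.neighborSet v)) (hw : G.Adj v w) :
    (G.neighborFinset v).erase w ∪ twinClass G v ⊆ G.neighborFinset w := by
  intro x hx
  rw [SimpleGraph.mem_neighborFinset]
  rcases Finset.mem_union.1 hx with hx | hx
  · obtain ⟨hne, hx⟩ := Finset.mem_erase.1 hx
    exact hv hw (by simpa using hx) hne.symm
  · exact adj_of_mem_twinClass hx hw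

/-- A neighbour of a simplicial vertex `v` is adjacent to the rest of the neighbourhood of `v` and
to all twins of `v`, which bounds the number of colours to be avoided at `v`. -/
theorem degree_add_card_twinClass_le (hG : G.Connected) {v : V}
    (hv : G.IsClique (G.neighborSet v)) :
    G.degree v + (twinClass G v).card ≤ G.maxDegree + 1 := by
  classical
  by_cases h : ∃ w, G.Adj v w
  · obtain ⟨w, hw⟩ := h
    have h1 := Finset.card_le_card (erase_union_twinClass_subset hv hw)
    have h2 := card_erase_union_twinClass hw
    have h3 := G.degree_le_maxDegree w
    simp only [SimpleGraph.card_neighborFinset_eq_degree] at h1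
    omega
  · push Not at h
    have h1 : G.degree v = 0 := by
      rw [← SimpleGraph.card_neighborFinset_eq_degree, Finset.card_eq_zero,
        Finset.eq_empty_iff_forall_notMem]
      simpa using h
    have h2 : (twinClass G v).card ≤ 1 := Finset.card_le_one.2 fun a _ b _ => by
      rw [eq_of_connected_of_forall_not_adj hG h a, eq_of_connected_of_forall_not_adj hG h b]
    omega

/-- If the bound `degree_add_card_twinClass_le` is attained at `v`, then the neighbours and the
twins of `v` have no further neighbours, and by connectedness they are all vertices. -/
theorem adj_or_mem_twinClass_of_maxDegree_lt (hG : G.Connected) {v : V}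
    (hv : G.IsClique (G.neighborSet v))
    (hlt : G.maxDegree < G.degree v + (twinClass G v).card) (u : V) :
    G.Adj v u ∨ u ∈ twinClass G v := by
  classical
  refine mem_of_connected_of_closed hG (A := {u | G.Adj v u ∨ u ∈ twinClass G v})
    (Or.inr (mem_twinClass_self G v)) ?_ u
  rintro x (hx | hx) w hw
  · have h1 := erase_union_twinClass_subset hv hx
    have h2 := card_erase_union_twinClass hx
    have h3 := G.degree_le_maxDegree x
    have h4 := Finset.eq_of_subset_of_card_le h1 (by
      rw [SimpleGraph.card_neighborFinset_eq_degree]; omega)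
    have hw' : w ∈ G.neighborFinset x := by simpa using hw
    rw [← h4, Finset.mem_union, Finset.mem_erase] at hw'
    exact hw'.imp (fun h => by simpa using h.2) id
  · exact Or.inl ((adj_congr_of_neighborSet_eq (mem_twinClass.1 hx) w).1 hw)

end TwinBound

/-- If the closed neighbourhood of a simplicial vertex `v` and the twins of `v` exhaust the graph,
the graph is the join of the independent set of the twins with the clique of the neighbours. -/
theorem nonempty_iso_isolatedJoinClique [Fintype V] {G : SimpleGraph V} {v : V}
    (hv : G.IsClique (G.neighborSet v))
    (hall : ∀ u, G.Adj v u ∨ u ∈ twinClass G v) :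
    Nonempty (G ≃g isolatedJoinClique G.indepNum (G.cliqueNum - 1)) := by
  classical
  set T := twinClass G v with hT
  have hTT : ∀ {x y}, x ∈ T → y ∈ T → ¬ G.Adj x y := fun hx hy h =>
    (adj_of_mem_twinClass hy ((adj_congr_of_neighborSet_eq (mem_twinClass.1 hx) _).1 h)).ne rfl
  have hNT : ∀ {x}, x ∉ T → G.Adj v x := fun hx => (hall _).resolve_right hx
  have hTN : ∀ {x y}, x ∈ T → y ∉ T → G.Adj x y := fun hx hy =>
    (adj_of_mem_twinClass hx (hNT hy)).symm
  have hNN : ∀ {x y}, x ∉ T → y ∉ T → x ≠ y → G.Adj x y := fun hx hy h =>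
    hv (hNT hx) (hNT hy) h
  have hvT : v ∈ T := mem_twinClass_self G v
  have hα : T.card = G.indepNum := by
    refine le_antisymm (SimpleGraph.IsIndepSet.card_le_indepNum fun x hx y hy _ => hTT hx hy) ?_
    obtain ⟨s, hs⟩ := G.exists_isNIndepSet_indepNum
    rw [← hs.card_eq]
    by_cases h : ∃ x ∈ s, x ∉ T
    · -- An independent set that meets the clique consists of a single vertex.
      obtain ⟨x, hxs, hx⟩ := h
      refine le_trans (Finset.card_le_one.2 ?_) (Finset.card_pos.2 ⟨v, hvT⟩)
      have : ∀ y ∈ s, y = x := fun y hy => by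
        by_contra hne
        by_cases hyT : y ∈ T
        · exact hs.isIndepSet hy hxs hne (hTN hyT hx)
        · exact hs.isIndepSet hy hxs hne (hNN hyT hx hne)
      intro a ha b hb
      rw [this a ha, this b hb]
    · push Not at h
      exact Finset.card_le_card h
  have hω : Tᶜ.card = G.cliqueNum - 1 := by
    have h1 : (insert v Tᶜ).card ≤ G.cliqueNum := by
      refine SimpleGraph.IsClique.card_le_cliqueNum (tc := ?_)
      rw [Finset.coe_insert, SimpleGraph.isClique_insert]
      exact ⟨fun x hx y hy h => hNN (by simpa using hx) (by simpa using hy) h,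
        fun b hb _ => hNT (by simpa using hb)⟩
    rw [Finset.card_insert_of_notMem (by simpa using hvT)] at h1
    obtain ⟨s, hs⟩ := G.exists_isNClique_cliqueNum
    have h2 : (s ∩ T).card ≤ 1 := Finset.card_le_one.2 fun a ha b hb => by
      rw [Finset.mem_inter] at ha hb
      by_contra hne
      exact hTT ha.2 hb.2 (hs.isClique ha.1 hb.1 hne)
    have h3 := Finset.card_inter_add_card_sdiff s T
    have h4 : (s \ T).card ≤ Tᶜ.card := Finset.card_le_card fun x hx => by
      simpa using (Finset.mem_sdiff.1 hx).2
    have := hs.card_eq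
    omega
  let e₁ : {x // x ∈ T} ≃ Fin G.indepNum := T.equivFinOfCardEq hα
  let e₂ : {x // x ∉ T} ≃ Fin (G.cliqueNum - 1) :=
    (Equiv.subtypeEquivRight fun x => by simp).trans (Tᶜ.equivFinOfCardEq hω)
  let e := (Equiv.sumCompl (· ∈ T)).symm.trans (Equiv.sumCongr e₁ e₂)
  have he₁ : ∀ x (hx : x ∈ T), e x = Sum.inl (e₁ ⟨x, hx⟩) := fun x hx => by
    simp [e, Equiv.sumCompl_symm_apply_of_pos hx]
  have he₂ : ∀ x (hx : x ∉ T), e x = Sum.inr (e₂ ⟨x, hx⟩) := fun x hx => by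
    simp [e, Equiv.sumCompl_symm_apply_of_neg hx]
  refine ⟨⟨e, fun {x y} => ?_⟩⟩
  by_cases hx : x ∈ T <;> by_cases hy : y ∈ T
  · rw [he₁ x hx, he₁ y hy]
    simp [isolatedJoinClique, join, hTT hx hy]
  · rw [he₁ x hx, he₂ y hy]
    simp [isolatedJoinClique, join, hTN hx hy]
  · rw [he₂ x hx, he₁ y hy]
    simp [isolatedJoinClique, join, (hTN hy hx).symm]
  · rw [he₂ x hx, he₂ y hy]
    have : G.Adj x y ↔ x ≠ y := ⟨fun h => h.ne, hNN hx hy⟩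
    simp [isolatedJoinClique, join, this]

/-- The least number of colours is attained. -/
theorem exists_distinguishing_coloring_distChromaticNumber [Fintype V] (G : SimpleGraph V) :
    ∃ c : G.Coloring (Fin (distChromaticNumber G)), IsDistinguishing G c :=
  Nat.sInf_mem (s := {k : ℕ | ∃ c : G.Coloring (Fin k), IsDistinguishing G c})
    ⟨_, exists_distinguishing_coloring G⟩

/-- In `a K₁ + K_b` distinct vertices are adjacent or false twins, so all colours differ. -/
theorem card_le_distChromaticNumber_of_iso_isolatedJoinClique [Fintype V] {G : SimpleGraph V}
    {a b : ℕ} (e : G ≃g isolatedJoinClique a b) : Fintype.card V ≤ distChromaticNumber G := by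
  obtain ⟨c, hc⟩ := exists_distinguishing_coloring_distChromaticNumber G
  have hinj : Function.Injective c := by
    intro u v huv
    have hadj : ¬ G.Adj u v := fun h => c.valid h huv
    by_contra hne
    refine hne (hc.eq_of_neighborSet_eq ?_ huv)
    have hne' : e u ≠ e v := e.injective.ne hne
    rw [← e.map_adj_iff] at hadj
    ext w
    rw [SimpleGraph.mem_neighborSet, SimpleGraph.mem_neighborSet, ← e.map_adj_iff,
      ← e.map_adj_iff (w := w)]
    revert hadj hne'
    generalize e u = x, e v = y, e w = z
    rcases x with x | x <;> rcases y with y | y <;> rcases z with z | z <;>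
      simp +contextual [isolatedJoinClique, join]
  simpa using Fintype.card_le_of_injective c hinj

/-- An odd cycle is not 2-colourable. -/
theorem three_le_distChromaticNumber_of_iso_cycleGraph_five [Fintype V] {G : SimpleGraph V}
    (e : G ≃g SimpleGraph.cycleGraph 5) : 3 ≤ distChromaticNumber G := by
  obtain ⟨c, -⟩ := exists_distinguishing_coloring_distChromaticNumber G
  have hcol : (SimpleGraph.cycleGraph 5).Colorable (distChromaticNumber G) :=
    ⟨c.comp e.symm.toHom⟩
  have h := hcol.chromaticNumber_le
  rw [SimpleGraph.chromaticNumber_cycleGraph_of_odd 5 (by norm_num) (by decide)] at h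
  exact_mod_cast h

/-! ### Graphs with an induced five-cycle -/

section InducedFiveCycle

variable {G : SimpleGraph V} (p : SimpleGraph.cycleGraph 5 ↪g G)

/-- In a `(C₄, 2K₂)`-free graph, a vertex outside an induced `C₅` with a neighbour on it is adjacent
to all of it. -/
theorem forall_adj_of_adj_fiveCycle (hC4 : IsInducedFree (SimpleGraph.cycleGraph 4) G)
    (h2K2 : IsInducedFree twoK2 G) {v : V} (hv : ∀ j, p j ≠ v) {i : Fin 5} (hi : G.Adj v (p i))
    (j : Fin 5) : G.Adj v (p j) := by
  classical
  -- The two rules that `2K₂`- and `C₄`-freeness impose on the set of neighbours on the cycle.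
  have key : ∀ a : Fin 5 → Bool, (∀ i, a i → a (i + 2) ∨ a (i + 3)) →
      (∀ i, a i → a (i + 2) → a (i + 1)) → ∀ i, a i → ∀ j, a j := by
    decide
  have hadj : ∀ i : Fin 5, (SimpleGraph.cycleGraph 5).Adj i (i + 1) ∧
      (SimpleGraph.cycleGraph 5).Adj (i + 1) (i + 2) ∧
      (SimpleGraph.cycleGraph 5).Adj (i + 2) (i + 3) ∧
      ¬ (SimpleGraph.cycleGraph 5).Adj i (i + 2) ∧
      ¬ (SimpleGraph.cycleGraph 5).Adj i (i + 3) := by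
    decide
  have h := key (fun i => decide (G.Adj v (p i))) (fun i h => ?_) (fun i h h' => ?_) i
    (by simpa using hi) j
  · simpa using h
  · obtain ⟨-, -, h1, h2, h3⟩ := hadj i
    rw [← p.map_adj_iff] at h1 h2 h3
    simp only [decide_eq_true_eq] at h ⊢
    rcases adj_of_isInducedFree_twoK2 h2K2 h h1 with h | h | h | h
    · exact Or.inl h
    · exact Or.inr h
    · exact absurd h h2
    · exact absurd h h3
  · obtain ⟨h1, h2, -, h3, -⟩ := hadj i
    rw [← p.map_adj_iff] at h1 h2 h3
    simp only [decide_eq_true_eq] at h h' ⊢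
    have hne : ∀ i : Fin 5, i ≠ i + 2 := by decide
    exact (adj_or_adj_of_isInducedFree_cycleGraph_four hC4 h h1 h2 h'.symm (hv _).symm
      (p.injective.ne (hne i))).resolve_right h3

/-- The vertices adjacent to all of an induced `C₅` form a clique: two non-adjacent ones and two
non-adjacent vertices of the cycle would form a `C₄`. -/
theorem adj_of_forall_adj_fiveCycle (hC4 : IsInducedFree (SimpleGraph.cycleGraph 4) G) {u v : V}
    (hu : ∀ j, G.Adj u (p j)) (hv : ∀ j, G.Adj v (p j)) (huv : u ≠ v) : G.Adj u v := by
  have h : ¬ G.Adj (p 0) (p 2) := by rw [p.map_adj_iff]; decide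
  exact (adj_or_adj_of_isInducedFree_cycleGraph_four hC4 (hu 0) (hv 0).symm (hv 2) (hu 2).symm huv
    (p.injective.ne (by decide))).resolve_right h

/-- The vertices without neighbours on an induced `C₅` are independent: an edge between two of them
and an edge of the cycle would form a `2K₂`. -/
theorem not_adj_of_forall_not_adj_fiveCycle (h2K2 : IsInducedFree twoK2 G) {u v : V}
    (hu : ∀ j, ¬ G.Adj u (p j)) (hv : ∀ j, ¬ G.Adj v (p j)) : ¬ G.Adj u v := by
  intro huv
  have h : G.Adj (p 0) (p 1) := by rw [p.map_adj_iff]; decide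
  rcases adj_of_isInducedFree_twoK2 h2K2 huv h with h | h | h | h
  exacts [hu _ h, hu _ h, hv _ h, hv _ h]

/-- The vertices adjacent to all of an induced `C₅`. -/
def fiveCycleHub [Fintype V] [DecidableRel G.Adj] : Finset V := {v | ∀ j, G.Adj v (p j)}

theorem mem_fiveCycleHub [Fintype V] [DecidableRel G.Adj] {v : V} :
    v ∈ fiveCycleHub p ↔ ∀ j, G.Adj v (p j) := by
  simp [fiveCycleHub]

/-- A colouring of `C₅` that is proper and distinguishing. -/
def fiveCycleColor : Fin 5 → ℕ := ![0, 1, 0, 1, 2]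

variable [Fintype V] [DecidableRel G.Adj]

theorem fiveCycle_notMem_hub (i : Fin 5) : p i ∉ fiveCycleHub p :=
  fun h => ((mem_fiveCycleHub p).1 h i).ne rfl

/-- With `h` vertices in the hub, hub vertices have degree at least `h + 4`, cycle vertices have
degree between `h + 2` and `h + 3`, and the remaining vertices have degree at most `h`. -/
theorem card_hub_add_four_le_degree (hC4 : IsInducedFree (SimpleGraph.cycleGraph 4) G) {v : V}
    (hv : v ∈ fiveCycleHub p) : (fiveCycleHub p).card + 4 ≤ G.degree v := by
  classical
  have hsub : (fiveCycleHub p).erase v ∪ Finset.univ.map p.toEmbedding ⊆ G.neighborFinset v := by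
    intro x hx
    rw [SimpleGraph.mem_neighborFinset]
    rcases Finset.mem_union.1 hx with hx | hx
    · obtain ⟨hne, hx⟩ := Finset.mem_erase.1 hx
      exact adj_of_forall_adj_fiveCycle p hC4 ((mem_fiveCycleHub p).1 hv)
        ((mem_fiveCycleHub p).1 hx) hne.symm
    · obtain ⟨i, -, rfl⟩ := Finset.mem_map.1 hx
      exact (mem_fiveCycleHub p).1 hv i
  have h1 := Finset.card_le_card hsub
  rw [Finset.card_union_of_disjoint, Finset.card_map, Finset.card_univ, Fintype.card_fin,
    SimpleGraph.card_neighborFinset_eq_degree] at h1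
  · have := Finset.card_erase_add_one hv
    omega
  · rw [Finset.disjoint_left]
    rintro x hx hx'
    obtain ⟨i, -, rfl⟩ := Finset.mem_map.1 hx'
    exact fiveCycle_notMem_hub p i (Finset.mem_of_mem_erase hx)

theorem card_hub_add_two_le_degree (i : Fin 5) :
    (fiveCycleHub p).card + 2 ≤ G.degree (p i) := by
  classical
  have hadj : ∀ i j : Fin 5, j ∈ ({i + 1, i + 4} : Finset (Fin 5)) →
      (SimpleGraph.cycleGraph 5).Adj i j := by
    decide
  have hne : ∀ i : Fin 5, i + 1 ≠ i + 4 := by decide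
  have hsub : fiveCycleHub p ∪ ({i + 1, i + 4} : Finset (Fin 5)).map p.toEmbedding ⊆
      G.neighborFinset (p i) := by
    intro x hx
    rw [SimpleGraph.mem_neighborFinset]
    rcases Finset.mem_union.1 hx with hx | hx
    · exact ((mem_fiveCycleHub p).1 hx i).symm
    · obtain ⟨j, hj, rfl⟩ := Finset.mem_map.1 hx
      exact p.map_adj_iff.2 (hadj i j hj)
  have h1 := Finset.card_le_card hsub
  rw [Finset.card_union_of_disjoint, Finset.card_map, Finset.card_pair (hne i),
    SimpleGraph.card_neighborFinset_eq_degree] at h1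
  · exact h1
  · rw [Finset.disjoint_left]
    rintro x hx hx'
    obtain ⟨j, -, rfl⟩ := Finset.mem_map.1 hx'
    exact fiveCycle_notMem_hub p j hx

theorem mem_hub_of_adj_fiveCycle (hC4 : IsInducedFree (SimpleGraph.cycleGraph 4) G)
    (h2K2 : IsInducedFree twoK2 G) {v : V} (hv : ∀ j, p j ≠ v) {i : Fin 5}
    (hi : G.Adj v (p i)) : v ∈ fiveCycleHub p :=
  (mem_fiveCycleHub p).2 (forall_adj_of_adj_fiveCycle p hC4 h2K2 hv hi)

theorem degree_le_card_hub_add_three (hC4 : IsInducedFree (SimpleGraph.cycleGraph 4) G)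
    (h2K2 : IsInducedFree twoK2 G) (i : Fin 5) : G.degree (p i) ≤ (fiveCycleHub p).card + 3 := by
  classical
  have hnbr : ∀ i j, (SimpleGraph.cycleGraph 5).Adj i j →
      j ∈ ({i, i + 2} : Finset (Fin 5))ᶜ := by
    decide
  have hsub : G.neighborFinset (p i) ⊆
      fiveCycleHub p ∪ (({i, i + 2} : Finset (Fin 5))ᶜ).map p.toEmbedding := by
    intro x hx
    rw [SimpleGraph.mem_neighborFinset] at hx
    by_cases h : ∃ j, p j = x
    · obtain ⟨j, rfl⟩ := h
      exact Finset.mem_union_right _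
        (Finset.mem_map.2 ⟨j, hnbr i j (p.map_adj_iff.1 hx), rfl⟩)
    · push Not at h
      exact Finset.mem_union_left _ (mem_hub_of_adj_fiveCycle p hC4 h2K2 h hx.symm)
  have h1 := (Finset.card_le_card hsub).trans (Finset.card_union_le _ _)
  have h2 : ∀ i : Fin 5, ({i, i + 2} : Finset (Fin 5))ᶜ.card = 3 := by decide
  rwa [Finset.card_map, h2 i, SimpleGraph.card_neighborFinset_eq_degree] at h1

/-- The neighbours of a vertex without neighbours on the cycle lie in the hub. -/
theorem mem_hub_of_adj_of_forall_not_adj (hC4 : IsInducedFree (SimpleGraph.cycleGraph 4) G)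
    (h2K2 : IsInducedFree twoK2 G) {v w : V} (hv : ∀ j, ¬ G.Adj v (p j)) (hvw : G.Adj v w) :
    w ∈ fiveCycleHub p := by
  by_contra hw
  refine not_adj_of_forall_not_adj_fiveCycle p h2K2 hv (fun j hj => hw ?_) hvw
  exact mem_hub_of_adj_fiveCycle p hC4 h2K2 (by rintro i rfl; exact hv i hvw) hj

theorem degree_le_card_hub (hC4 : IsInducedFree (SimpleGraph.cycleGraph 4) G)
    (h2K2 : IsInducedFree twoK2 G) {v : V} (hv : ∀ j, ¬ G.Adj v (p j)) :
    G.degree v ≤ (fiveCycleHub p).card := by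
  rw [← SimpleGraph.card_neighborFinset_eq_degree]
  exact Finset.card_le_card fun w hw =>
    mem_hub_of_adj_of_forall_not_adj p hC4 h2K2 hv (by simpa using hw)

/-- Every vertex lies in the hub, on the cycle, or has no neighbour on the cycle. -/
theorem fiveCycle_trichotomy (hC4 : IsInducedFree (SimpleGraph.cycleGraph 4) G)
    (h2K2 : IsInducedFree twoK2 G) (v : V) :
    v ∈ fiveCycleHub p ∨ (∃ j, p j = v) ∨ ∀ j, ¬ G.Adj v (p j) := by
  by_contra! h
  obtain ⟨h1, h2, j, hj⟩ := h
  exact h1 (mem_hub_of_adj_fiveCycle p hC4 h2K2 h2 hj)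

/-- A proper colouring of the conflict graph is distinguishing if it is injective on the hub and
induces `fiveCycleColor` on the cycle: by their degrees the three parts of the graph are
preserved by all automorphisms, and each part is fixed pointwise. -/
theorem isDistinguishing_of_fiveCycle {α : Type*}
    (hC4 : IsInducedFree (SimpleGraph.cycleGraph 4) G) (h2K2 : IsInducedFree twoK2 G)
    (c : (conflictGraph G).Coloring α) (hK : Set.InjOn c (fiveCycleHub p))
    (hcyc : ∀ i j, c (p i) = c (p j) → fiveCycleColor i = fiveCycleColor j) :
    IsDistinguishing G c := by
  intro φ hφ
  have hdeg : ∀ v, G.degree (φ v) = G.degree v := fun v => φ.degree_eq v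
  have htri := fiveCycle_trichotomy p hC4 h2K2
  have hK' : ∀ v ∈ fiveCycleHub p, φ v ∈ fiveCycleHub p := by
    intro v hv
    have h1 := card_hub_add_four_le_degree p hC4 hv
    rcases htri (φ v) with h | ⟨j, h⟩ | h
    · exact h
    · have h2 := degree_le_card_hub_add_three p hC4 h2K2 j
      rw [h, hdeg] at h2; omega
    · have h2 := degree_le_card_hub p hC4 h2K2 h
      rw [hdeg] at h2; omega
  have hKfix : ∀ v ∈ fiveCycleHub p, φ v = v := fun v hv => hK (hK' v hv) hv (hφ v)
  have hcyc' : ∀ i, ∃ j, p j = φ (p i) := by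
    intro i
    have h1 := card_hub_add_two_le_degree p i
    have h2 := degree_le_card_hub_add_three p hC4 h2K2 i
    rcases htri (φ (p i)) with h | h | h
    · have h3 := card_hub_add_four_le_degree p hC4 h
      rw [hdeg] at h3; omega
    · exact h
    · have h3 := degree_le_card_hub p hC4 h2K2 h
      rw [hdeg] at h3; omega
  have hcolor : ∀ i j, p j = φ (p i) → fiveCycleColor j = fiveCycleColor i := fun i j h =>
    hcyc j i (by rw [h, hφ])
  -- The vertex 4 is the only one of its colour, and adjacency to it tells apart the vertices
  -- of each of the other two colours.
  have h4 : φ (p 4) = p 4 := by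
    obtain ⟨j, hj⟩ := hcyc' 4
    have : ∀ j, fiveCycleColor j = fiveCycleColor 4 → j = 4 := by decide
    rw [← hj, this j (hcolor 4 j hj)]
  have hcycfix : ∀ i, φ (p i) = p i := by
    intro i
    obtain ⟨j, hj⟩ := hcyc' i
    have key : ∀ i j, fiveCycleColor j = fiveCycleColor i →
        ((SimpleGraph.cycleGraph 5).Adj 4 j ↔ (SimpleGraph.cycleGraph 5).Adj 4 i) → j = i := by
      decide
    rw [← hj, key i j (hcolor i j hj)]
    rw [← p.map_adj_iff, ← p.map_adj_iff, hj]
    nth_rewrite 1 [← h4]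
    exact φ.map_adj_iff
  intro v
  rcases htri v with h | ⟨j, rfl⟩ | h
  · exact hKfix v h
  · exact hcycfix j
  · refine apply_eq_of_neighborSet_subset c φ hφ hKfix
      (fun w hw => mem_hub_of_adj_of_forall_not_adj p hC4 h2K2 h hw)
      (fun w hw => mem_hub_of_adj_of_forall_not_adj p hC4 h2K2 (fun j hj => h j ?_) hw)
    rwa [← hcycfix j, φ.map_adj_iff] at hj

/-- The colouring bound in the presence of an induced `C₅`: three colours for the cycle, further
colours for the hub, and a greedy extension to the other vertices. -/
theorem distChromaticNumber_le_of_fiveCycle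
    (hC4 : IsInducedFree (SimpleGraph.cycleGraph 4) G) (h2K2 : IsInducedFree twoK2 G) {k : ℕ}
    (hKk : (fiveCycleHub p).card + 3 ≤ k)
    (hk : ∀ v, (∀ j, p j ≠ v) → (∀ j, ¬ G.Adj v (p j)) →
      G.degree v + (twinClass G v).card ≤ k) :
    distChromaticNumber G ≤ k := by
  classical
  set K := fiveCycleHub p with hKdef
  -- The colours 0, 1, 2 are reserved for the cycle.
  let c₀ : V → ℕ := fun v =>
    if h : v ∈ K then K.equivFin ⟨v, h⟩ + 3 else Function.extend p fiveCycleColor 0 v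
  have hc₀K : ∀ v (h : v ∈ K), c₀ v = K.equivFin ⟨v, h⟩ + 3 := fun v h => dif_pos h
  have hc₀C : ∀ i, c₀ (p i) = fiveCycleColor i := fun i =>
    (dif_neg (fiveCycle_notMem_hub p i)).trans (p.injective.extend_apply _ _ i)
  have hC3 : ∀ i, fiveCycleColor i < 3 := by decide
  have hproper : ∀ i j, (SimpleGraph.cycleGraph 5).Adj i j →
      fiveCycleColor i ≠ fiveCycleColor j := by
    decide
  have htwin : ∀ i j, (∀ l, (SimpleGraph.cycleGraph 5).Adj i l ↔
      (SimpleGraph.cycleGraph 5).Adj j l) → i = j := by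
    decide
  have hinj : ∀ u ∈ K, ∀ v ∈ K, c₀ u = c₀ v → u = v := by
    intro u hu v hv h
    rw [hc₀K u hu, hc₀K v hv] at h
    simpa using K.equivFin.injective (Fin.ext (Nat.add_right_cancel h))
  have hmem : ∀ v, v ∈ K ∪ Finset.univ.map p.toEmbedding → v ∈ K ∨ ∃ i, p i = v := by
    intro v hv
    simpa using hv
  obtain ⟨c, hc⟩ := exists_coloring_extending (conflictGraph G) (k := k)
    (K ∪ Finset.univ.map p.toEmbedding) c₀
    (fun v hv => by
      rcases hmem v hv with h | ⟨i, rfl⟩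
      · rw [hc₀K v h]
        have := (K.equivFin ⟨v, h⟩).is_lt
        omega
      · rw [hc₀C]
        have := hC3 i
        omega)
    (fun u hu v hv huv h => by
      rcases hmem u hu with hu | ⟨i, rfl⟩ <;> rcases hmem v hv with hv | ⟨j, rfl⟩
      · exact huv.1 (hinj u hu v hv h)
      · rw [hc₀K u hu, hc₀C] at h
        have := hC3 j
        omega
      · rw [hc₀K v hv, hc₀C] at h
        have := hC3 i
        omega
      · rw [hc₀C, hc₀C] at h
        rcases huv.2 with h' | h'
        · exact hproper i j (p.map_adj_iff.1 h') h
        · have hij : ∀ l, (SimpleGraph.cycleGraph 5).Adj i l ↔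
              (SimpleGraph.cycleGraph 5).Adj j l := fun l => by
            rw [← p.map_adj_iff, ← p.map_adj_iff]
            exact adj_congr_of_neighborSet_eq h' (p l)
          exact huv.1 (congrArg p (htwin i j hij)))
    (fun v hv => (degree_conflictGraph_lt G v).trans_le <| by
      have hv' : v ∉ K ∧ ∀ j, p j ≠ v := by simpa using hv
      rcases fiveCycle_trichotomy p hC4 h2K2 v with h | ⟨j, h⟩ | h
      · exact absurd h hv'.1
      · exact absurd h (hv'.2 j)
      · exact hk v hv'.2 h)
  have hcC : ∀ i, (c (p i) : ℕ) = fiveCycleColor i := fun i =>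
    (hc _ (by simp)).trans (hc₀C i)
  refine distChromaticNumber_le_of_conflictGraph_coloring c
    (isDistinguishing_of_fiveCycle p hC4 h2K2 c (fun u hu v hv h => ?_) fun i j h => ?_)
  · refine hinj u hu v hv ?_
    rw [← hc u (Finset.mem_union_left _ hu), ← hc v (Finset.mem_union_left _ hv), h]
  · rw [← hcC, ← hcC, h]

end InducedFiveCycle

/-! ### The bounds for the two classes -/

section Bounds

variable [Fintype V] {G : SimpleGraph V} [DecidableRel G.Adj]

/-- A connected split graph is coloured with `Δ + 1` colours, and with `Δ` colours unless it is the
join of an independent set with a clique. -/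
theorem distChromaticNumber_bounds_of_split (hconn : G.Connected) {K : Finset V} (hK : G.IsClique K)
    (hI : ∀ u ∉ K, ∀ v ∉ K, ¬ G.Adj u v) :
    distChromaticNumber G ≤ G.maxDegree + 1 ∧
    (G.maxDegree < distChromaticNumber G →
      Nonempty (G ≃g isolatedJoinClique G.indepNum (G.cliqueNum - 1))) := by
  classical
  have hclique : ∀ v ∉ K, G.IsClique (G.neighborSet v) := fun v hv =>
    hK.subset fun w hw => by
      by_contra h
      exact hI v hv w h hw
  have hKsub : ∀ v ∈ K, K.erase v ⊆ G.neighborFinset v := fun v hv w hw => by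
    rw [SimpleGraph.mem_neighborFinset]
    exact hK hv (Finset.mem_of_mem_erase hw) (Finset.ne_of_mem_erase hw).symm
  have hKdeg : ∀ v ∈ K, K.card ≤ G.degree v + 1 := fun v hv => by
    have h := Finset.card_le_card (hKsub v hv)
    rw [SimpleGraph.card_neighborFinset_eq_degree] at h
    have := Finset.card_erase_add_one hv
    omega
  refine ⟨distChromaticNumber_le_of_split hI hK ?_ fun v hv =>
    degree_add_card_twinClass_le hconn (hclique v hv), fun hlt => ?_⟩
  · rcases K.eq_empty_or_nonempty with rfl | ⟨v, hv⟩
    · simp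
    · exact (hKdeg v hv).trans (Nat.add_le_add_right (G.degree_le_maxDegree v) 1)
  · have hsimp : ∃ v, G.IsClique (G.neighborSet v) ∧
        G.maxDegree < G.degree v + (twinClass G v).card := by
      by_contra! h
      refine hlt.not_ge (distChromaticNumber_le_of_split hI hK ?_ fun v hv => h v (hclique v hv))
      by_contra! hKΔ
      -- A clique on `Δ + 1` vertices contains all neighbours of its vertices.
      obtain ⟨v, hv⟩ := Finset.card_pos.1 (Nat.zero_lt_of_lt hKΔ)
      have h1 := G.degree_le_maxDegree v
      have h2 := hKdeg v hv
      have h3 := Finset.card_erase_add_one hv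
      have h4 := Finset.eq_of_subset_of_card_le (hKsub v hv) (by
        rw [SimpleGraph.card_neighborFinset_eq_degree]; omega)
      have h5 : G.IsClique (G.neighborSet v) := hK.subset fun w hw => by
        have : w ∈ G.neighborFinset v := by simpa using hw
        rw [← h4] at this
        exact Finset.mem_of_mem_erase this
      have h6 := Finset.card_pos.2 ⟨v, mem_twinClass_self G v⟩
      have h7 := h v h5
      omega
    obtain ⟨v, hv, hvlt⟩ := hsimp
    exact nonempty_iso_isolatedJoinClique hv
      (adj_or_mem_twinClass_of_maxDegree_lt hconn hv hvlt)

/-- A connected `(C₄, 2K₂)`-free graph with an induced `C₅` is coloured with `Δ + 1` colours, and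
with `Δ` colours unless it is `C₅`. -/
theorem distChromaticNumber_bounds_of_fiveCycle (hconn : G.Connected)
    (hC4 : IsInducedFree (SimpleGraph.cycleGraph 4) G) (h2K2 : IsInducedFree twoK2 G)
    (p : SimpleGraph.cycleGraph 5 ↪g G) :
    distChromaticNumber G ≤ G.maxDegree + 1 ∧
    (G.maxDegree < distChromaticNumber G → Nonempty (G ≃g SimpleGraph.cycleGraph 5)) := by
  have hI : ∀ v, (∀ j, ¬ G.Adj v (p j)) →
      G.degree v + (twinClass G v).card ≤ G.maxDegree := by
    intro v hv
    by_contra! hlt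
    have hclique : G.IsClique (G.neighborSet v) := fun a ha b hb hab =>
      adj_of_forall_adj_fiveCycle p hC4
        ((mem_fiveCycleHub p).1 (mem_hub_of_adj_of_forall_not_adj p hC4 h2K2 hv ha))
        ((mem_fiveCycleHub p).1 (mem_hub_of_adj_of_forall_not_adj p hC4 h2K2 hv hb)) hab
    -- The cycle vertex `p 0` is neither a neighbour of `v` nor, having the neighbour `p 1`, a twin.
    rcases adj_or_mem_twinClass_of_maxDegree_lt hconn hclique hlt (p 0) with h | h
    · exact hv 0 h
    · refine hv 1 ((adj_congr_of_neighborSet_eq (mem_twinClass.1 h) _).1 ?_)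
      rw [p.map_adj_iff]
      decide
  refine ⟨distChromaticNumber_le_of_fiveCycle p hC4 h2K2 ?_ fun v _ hv => (hI v hv).trans
    (Nat.le_succ _), fun hlt => ?_⟩
  · have h1 := card_hub_add_two_le_degree p 0
    have h2 := G.degree_le_maxDegree (p 0)
    omega
  · have hempty : ∀ v, v ∉ fiveCycleHub p := fun v hv => by
      have h1 := card_hub_add_four_le_degree p hC4 hv
      have h2 := G.degree_le_maxDegree v
      exact hlt.not_ge (distChromaticNumber_le_of_fiveCycle p hC4 h2K2 (by omega)
        fun v _ hv => hI v hv)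
    have hsurj : Function.Surjective p := fun v =>
      mem_of_connected_of_closed hconn (A := Set.range p) ⟨0, rfl⟩ (by
        rintro _ ⟨i, rfl⟩ w hw
        by_contra h
        exact hempty w (mem_hub_of_adj_fiveCycle p hC4 h2K2 (fun j hj => h ⟨j, hj⟩) hw.symm)) v
    exact ⟨(RelIso.ofSurjective p hsurj).symm⟩

end Bounds

end DistinguishingChromatic

open DistinguishingChromatic in
theorem mainTheorem3 {V : Type*} [Fintype V] (G : SimpleGraph V) [DecidableRel G.Adj]
    (hconn : G.Connected)
    (hC4 : DistinguishingChromatic.IsInducedFree (SimpleGraph.cycleGraph 4) G)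
    (h2K2 : DistinguishingChromatic.IsInducedFree DistinguishingChromatic.twoK2 G) :
    DistinguishingChromatic.distChromaticNumber G ≤ G.maxDegree + 1 ∧
    (DistinguishingChromatic.distChromaticNumber G = G.maxDegree + 1 ↔
      Nonempty (G ≃g DistinguishingChromatic.isolatedJoinClique G.indepNum (G.cliqueNum - 1)) ∨
      Nonempty (G ≃g SimpleGraph.cycleGraph 5)) := by
  have hupper : distChromaticNumber G ≤ G.maxDegree + 1 ∧ (G.maxDegree < distChromaticNumber G →
      Nonempty (G ≃g isolatedJoinClique G.indepNum (G.cliqueNum - 1)) ∨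
      Nonempty (G ≃g SimpleGraph.cycleGraph 5)) := by
    by_cases hC5 : IsEmpty (SimpleGraph.cycleGraph 5 ↪g G)
    · obtain ⟨K, hK, hI⟩ := exists_isClique_isIndepSet_compl hC4 h2K2 hC5
      exact (distChromaticNumber_bounds_of_split hconn hK hI).imp_right fun h hlt => Or.inl (h hlt)
    · obtain ⟨p⟩ := not_isEmpty_iff.1 hC5
      exact (distChromaticNumber_bounds_of_fiveCycle hconn hC4 h2K2 p).imp_right
        fun h hlt => Or.inr (h hlt)
  refine ⟨hupper.1, fun h => hupper.2 (by omega), fun h => le_antisymm hupper.1 ?_⟩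
  rcases h with ⟨⟨e⟩⟩ | ⟨⟨e⟩⟩
  · have := hconn.nonempty
    exact G.maxDegree_lt_card_verts.trans_le
      (card_le_distChromaticNumber_of_iso_isolatedJoinClique e)
  · refine le_trans ?_ (three_le_distChromaticNumber_of_iso_cycleGraph_five e)
    refine Nat.succ_le_succ (G.maxDegree_le_of_forall_degree_le 2 fun v => ?_)
    rw [← e.degree_eq v, SimpleGraph.cycleGraph_degree_three_le]
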